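/- \textbf{Setting.} Classical modal formulae are built from a countably infinite set of variables by $\bot,\top,\wedge,\neg,\square$; write $\square^+\varphi:=\square\varphi\wedge\varphi$. A \emph{clm-rule} $\Gamma/\Delta$ is a pair of finite sets of such formulae. A \emph{clm-rule system} is a set of clm-rules that is closed under substitution, weakening by finite sets on both sides, and cut, and that contains $\varphi/\varphi$, $\ \varphi,\varphi\to\psi/\psi$ and $\varphi/\square\varphi$ for all formulae $\varphi,\psi$. For a rule system $S$ and a set $A$ of rules, $S\oplus A$ is the least rule system containing $S\cup A$. $\mathsf{K4}$ is the least clm-rule system containing $/\varphi$ for every $\varphi$ valid in all transitive Kripke frames, and $\mathsf{GL}:=\mathsf{K4}\oplus\{/\square(\square p\to p)\to\square p\}$. A \emph{modal algebra} is a Boolean algebra (possibly with one element) with an operation $\square$ such that $\square 1=1$ and $\square(a\wedge b)=\square a\wedge\square b$; it is a \emph{Magari algebra} if moreover $\square a\le\square\square a$ and $\square(\square a\to a)\le\square a$. A modal algebra validates $\Gamma/\Delta$ if every valuation that gives all members of $\Gamma$ the value $1$ gives some member of $\Delta$ the value $1$. For a finite modal algebra $M$, a set $D\subseteq M$ and pairwise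 distinct variables $p_a$ $(a\in M)$, the \emph{clm pre-stable canonical rule} of $(M,D)$ is $\Gamma/\Delta$ with \[\Gamma=\{p_0\leftrightarrow\bot,\ p_1\leftrightarrow\top\}\cup\{p_{a\wedge b}\leftrightarrow p_a\wedge p_b: a,b\in M\}\cup\{p_{\neg a}\leftrightarrow\neg p_a: a\in M\}\cup\{p_{\square^+a}\to\square^+p_a: a\in M\}\cup\{p_{\square a}\leftrightarrow\square p_a: a\in D\},\] \[\Delta=\{p_a: a\in M,\ a\neq 1\}.\] Let $F$ be a finite set (possibly empty) with a binary relation $R$; its dual algebra is $\wp(F)$ with $\square U=\{x: R[x]\subseteq U\}$. For a set $\mathcal D$ of subsets of $F$, the clm pre-stable canonical rule of $(F,\mathcal D)$ is that of $(\wp(F),\{F\setminus d: d\in\mathcal D\})$. It is called \emph{classicized} if $\wp(F)$ is a Magari algebra (so $F$ is a finite $\mathsf{GL}$-space), $F$ is skeletal (i.e. $xRy$ and $yRx$ imply $x=y$), and every $d\in\mathcal D$ is a downset (i.e. $xRy$ and $y\in d$ imply $x\in d$). \textbf{Theorem.} Every clm-rule $\Gamma/\Delta$ is equivalent over $\mathsf{GL}$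 to finitely many classicized clm pre-stable canonical rules: there is a finite set $\Phi$ of classicized clm pre-stable canonical rules such that \[\mathsf{GL}\oplus\{\Gamma/\Delta\}=\mathsf{GL}\oplus\Phi,\] and a Magari algebra validates $\Gamma/\Delta$ if and only if it validates every rule in $\Phi$. -/

import Mathlib

universe u

namespace GLRules

/-! ### Classical modal formulae and multi-conclusion rules -/

/-- Classical modal formulae over the countably infinite set of variables `ℕ`. -/
inductive Fm : Type where
  | var : ℕ → Fm
  | bot : Fm
  | top : Fm
  | and : Fm → Fm → Fm
  | neg : Fm → Fm
  | box : Fm → Fm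
  deriving DecidableEq

namespace Fm

/-- The usual abbreviation of implication. -/
def imp (φ ψ : Fm) : Fm := neg (and φ (neg ψ))

/-- The usual abbreviation of the biconditional. -/
def iff (φ ψ : Fm) : Fm := and (imp φ ψ) (imp ψ φ)

/-- The compound modality `□⁺ φ = □ φ ∧ φ`. -/
def boxPlus (φ : Fm) : Fm := and (box φ) φ

/-- The extension of a substitution of the variables to all formulae. -/
def subst (s : ℕ → Fm) : Fm → Fm
  | var n => s n
  | bot => bot
  | top => top
  | and φ ψ => and (subst s φ) (subst s ψ)
  | neg φ => neg (subst s φ)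
  | box φ => box (subst s φ)

end Fm

/-- A rule `Γ / Δ`: a pair of finite sets of formulae. -/
@[ext]
structure Rule where
  prem : Finset Fm
  concl : Finset Fm

/-! ### Modal algebras -/

/-- Modal algebras. The one-element algebra is allowed. -/
class ModalAlgebra (M : Type u) extends BooleanAlgebra M where
  box : M → M
  box_top : box ⊤ = ⊤
  box_inf : ∀ a b : M, box (a ⊓ b) = box a ⊓ box b

/-- The operation `□⁺ a = □ a ∧ a`. -/
def boxPlus {M : Type u} [ModalAlgebra M] (a : M) : M := ModalAlgebra.box a ⊓ a

/-- `K4`-algebras: `□ a ≤ □ □ a`. -/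
def IsK4Algebra (M : Type u) [ModalAlgebra M] : Prop :=
  ∀ a : M, ModalAlgebra.box a ≤ ModalAlgebra.box (ModalAlgebra.box a)

/-- Magari algebras: `K4`-algebras with `□ (□ a → a) ≤ □ a`. -/
def IsMagari (M : Type u) [ModalAlgebra M] : Prop :=
  IsK4Algebra M ∧
    ∀ a : M, ModalAlgebra.box (ModalAlgebra.box a ⇨ a) ≤ ModalAlgebra.box a

/-- The valuation on `M` determined by the values of the variables. -/
def eval {M : Type u} [ModalAlgebra M] (v : ℕ → M) : Fm → M
  | .var n => v n
  | .bot => ⊥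
  | .top => ⊤
  | .and φ ψ => eval v φ ⊓ eval v ψ
  | .neg φ => (eval v φ)ᶜ
  | .box φ => ModalAlgebra.box (eval v φ)

/-- The rule `r` is valid on the algebra `M`. -/
def Validates (M : Type u) [ModalAlgebra M] (r : Rule) : Prop :=
  ∀ v : ℕ → M, (∀ γ ∈ r.prem, eval v γ = ⊤) → ∃ δ ∈ r.concl, eval v δ = ⊤

/-! ### Kripke frames -/

/-- Kripke frames. A finite modal space is the same thing as a finite Kripke frame, since
its topology is discrete. -/
structure Frame where
  carrier : Type u
  rel : carrier → carrier → Prop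

namespace Frame

/-- The carrier of the dual algebra of a frame: all subsets of the frame. -/
def Alg (X : Frame.{u}) : Type u := Set X.carrier

/-- The dual algebra, with `□ U = {x | ↑x ⊆ U}`. -/
instance instModalAlgebraAlg (X : Frame.{u}) : ModalAlgebra X.Alg where
  toBooleanAlgebra := inferInstanceAs (BooleanAlgebra (Set X.carrier))
  box := fun U : Set X.carrier => {x | ∀ y, X.rel x y → y ∈ U}
  box_top := Set.eq_univ_of_forall fun _ _ _ => Set.mem_univ _
  box_inf := fun _ _ => Set.ext fun _ =>
    ⟨fun h => ⟨fun y hy => (h y hy).1, fun y hy => (h y hy).2⟩,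
      fun h y hy => ⟨h.1 y hy, h.2 y hy⟩⟩

instance instFiniteAlg (X : Frame.{u}) [Finite X.carrier] : Finite X.Alg :=
  inferInstanceAs (Finite (Set X.carrier))

def IsTransitive (X : Frame.{u}) : Prop := ∀ x y z, X.rel x y → X.rel y z → X.rel x z

/-- A formula is valid in a frame when it is true at every point under every interpretation. -/
def ValidFm (X : Frame.{u}) (φ : Fm) : Prop := ∀ v : ℕ → X.Alg, eval v φ = ⊤

/-- `GL`-frames: the dual algebra is a Magari algebra. -/
def IsGL (X : Frame.{u}) : Prop := IsMagari X.Alg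

/-- Skeletal frames: points that see each other are equal, i.e. there are no proper clusters,
so that collapsing clusters changes nothing. -/
def IsSkeletal (X : Frame.{u}) : Prop := ∀ x y, X.rel x y → X.rel y x → x = y

def IsDownset (X : Frame.{u}) (d : Set X.carrier) : Prop :=
  ∀ x y, X.rel x y → y ∈ d → x ∈ d

end Frame

/-! ### Rule systems -/

/-- Rule systems: sets of rules closed under structurality, reflexivity, monotonicity, cut,
modus ponens and necessitation. -/
structure IsRuleSystem (S : Set Rule) : Prop where
  structural : ∀ (s : ℕ → Fm) (r : Rule), r ∈ S →
    (⟨r.prem.image (Fm.subst s), r.concl.image (Fm.subst s)⟩ : Rule) ∈ S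
  refl : ∀ φ : Fm, (⟨{φ}, {φ}⟩ : Rule) ∈ S
  mono : ∀ Γ Δ Γ' Δ' : Finset Fm, (⟨Γ, Δ⟩ : Rule) ∈ S → (⟨Γ ∪ Γ', Δ ∪ Δ'⟩ : Rule) ∈ S
  cut : ∀ (Γ Δ : Finset Fm) (φ : Fm), (⟨Γ, Δ ∪ {φ}⟩ : Rule) ∈ S →
    (⟨Γ ∪ {φ}, Δ⟩ : Rule) ∈ S → (⟨Γ, Δ⟩ : Rule) ∈ S
  modusPonens : ∀ φ ψ : Fm, (⟨{φ, Fm.imp φ ψ}, {ψ}⟩ : Rule) ∈ S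
  necessitation : ∀ φ : Fm, (⟨{φ}, {Fm.box φ}⟩ : Rule) ∈ S

/-- The least rule system containing a set of rules. -/
def generated (A : Set Rule) : Set Rule := ⋂₀ {S | IsRuleSystem S ∧ A ⊆ S}

/-- The extension `S ⊕ A` of the rule system `S` by the rules in `A`. -/
def extend (S A : Set Rule) : Set Rule := generated (S ∪ A)

/-- `K4`: the least rule system containing `/ φ` for all formulae `φ` that are valid in all
transitive Kripke frames. -/
def systemK4 : Set Rule :=
  generated {r | ∃ φ : Fm, (∀ X : Frame.{0}, X.IsTransitive → X.ValidFm φ) ∧ r = ⟨∅, {φ}⟩}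

/-- The Gödel–Löb rule `/ □ (□ p → p) → □ p`. -/
def loebRule : Rule :=
  ⟨∅, {Fm.imp (Fm.box (Fm.imp (Fm.box (Fm.var 0)) (Fm.var 0))) (Fm.box (Fm.var 0))}⟩

/-- `GL`: the extension of `K4` by the Gödel–Löb rule. -/
def systemGL : Set Rule := extend systemK4 {loebRule}

/-! ### Pre-stable canonical rules -/

open Classical in
/-- The pre-stable canonical rule of a finite modal algebra `M` with domain `D`, where `p a`
is the variable introduced for `a`. -/
noncomputable def preStableRule (M : Type u) [ModalAlgebra M] [Fintype M] (D : Finset M)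
    (p : M → ℕ) : Rule where
  prem :=
    {Fm.iff (.var (p ⊥)) .bot} ∪ {Fm.iff (.var (p ⊤)) .top} ∪
    Finset.univ.image (fun ab : M × M =>
      Fm.iff (.var (p (ab.1 ⊓ ab.2))) (.and (.var (p ab.1)) (.var (p ab.2)))) ∪
    Finset.univ.image (fun a : M => Fm.iff (.var (p aᶜ)) (.neg (.var (p a)))) ∪
    Finset.univ.image (fun a : M =>
      Fm.imp (.var (p (boxPlus a))) (Fm.boxPlus (.var (p a)))) ∪
    D.image (fun a : M => Fm.iff (.var (p (ModalAlgebra.box a))) (.box (.var (p a))))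
  concl := (Finset.univ.filter (fun a : M => a ≠ ⊤)).image (fun a : M => .var (p a))

open Classical in
/-- The pre-stable canonical rule of a finite frame `X` with a finite set `D` of subsets of `X`
as its domain: the rule of the dual algebra of `X` with the domain `{X \ d | d ∈ D}`. -/
noncomputable def framePreStableRule (X : Frame.{u}) [Finite X.carrier]
    (D : Finset (Set X.carrier)) (p : X.Alg → ℕ) : Rule :=
  letI : Fintype X.Alg := Fintype.ofFinite X.Alg
  preStableRule X.Alg (D.image fun d : Set X.carrier => (dᶜ : Set X.carrier)) p

/-- Classicized pre-stable canonical rules: those of finite skeletal `GL`-frames whose domain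
consists of downsets. Distinct elements of the dual algebra get distinct variables. -/
def IsClassicized (r : Rule) : Prop :=
  ∃ (X : Frame.{0}) (_ : Finite X.carrier) (D : Finset (Set X.carrier)) (p : X.Alg → ℕ),
    X.IsGL ∧ X.IsSkeletal ∧ (∀ d ∈ D, X.IsDownset d) ∧ Function.Injective p ∧
      r = framePreStableRule X D p

end GLRules

namespace GLRules

/-! ### Lindenbaum algebras and completeness of rule systems -/

/-! By algebraic completeness (`IsRuleSystem.exists_refuting`), equality of extensions of `GL`
reduces to validity on Magari algebras. It remains to code the refutations of a rule `r` on such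
algebras by finitely many finite frames.

Let `v` refute `r` on `M`. Colour each ultrafilter of `M` by the subformulae of `r` true at it, and
record the set `S` of colours visible at or above it. A point is final if every point above it sees
a different set. Final points keep their colour and get rank `2|S|`. Non-final points with the same
`S` are all merged into one point of rank `2|S| + 1`, whose colour is a member of `S` with the
fewest boxed formulae. Accessibility then becomes equality or a strict drop in rank, so the image,
related by strict descent, is a finite irreflexive transitive frame. Löb's axiom supplies a final
point for every visible set, so no colour is lost and the truth lemma `mem_eval_collapse_iff` holds.
The map dual to the collapse is an embedding that is stable for `□⁺` and preserves `□` at the sets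
`□⁺φ` with `□φ` a subformula. The complements of these sets are downsets. Only finitely many frames
arise, since their points are ranked colours.

Conversely, suppose such an embedding `h` exists. Preservation of `□` at `□⁺U` says that `h(□U)`
solves `b = □(b ∧ h U)`. In a Magari algebra the only solution is `□(h U)`, so `h` carries the
refutation over to `M` (`IsMagari.box_eq_of_eq_box_inf`, `not_validates_of_isPreStableEmbedding`).
-/

instance (X : Frame.{u}) : Membership X.carrier X.Alg :=
  inferInstanceAs (Membership X.carrier (Set X.carrier))

namespace Fm

/-- Truth of a formula at a point of a frame. -/
def Sat {X : Frame.{u}} (v : ℕ → X.Alg) (x : X.carrier) (φ : Fm) : Prop :=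
  x ∈ eval v φ

variable {X : Frame.{u}} (v : ℕ → X.Alg) (x : X.carrier) (φ ψ : Fm)

@[simp] theorem sat_top : Sat v x top := Set.mem_univ x

@[simp] theorem sat_bot : ¬ Sat v x bot := fun h => h

@[simp] theorem sat_and : Sat v x (and φ ψ) ↔ Sat v x φ ∧ Sat v x ψ := Iff.rfl

@[simp] theorem sat_neg : Sat v x (neg φ) ↔ ¬ Sat v x φ := Iff.rfl

@[simp] theorem sat_box : Sat v x (box φ) ↔ ∀ y, X.rel x y → Sat v y φ := Iff.rfl

@[simp] theorem sat_imp : Sat v x (imp φ ψ) ↔ (Sat v x φ → Sat v x ψ) := by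
  simp [imp]

/-- The usual abbreviation of disjunction. -/
def or (φ ψ : Fm) : Fm := neg (and (neg φ) (neg ψ))

@[simp] theorem sat_or : Sat v x (or φ ψ) ↔ Sat v x φ ∨ Sat v x ψ := by
  simp only [or, sat_neg, sat_and]; tauto

end Fm

open Fm

/-- Sets of formulae closed under the theorems of `K4`, modus ponens and necessitation. -/
structure IsTheory (T : Set Fm) : Prop where
  valid : ∀ φ : Fm, (∀ X : Frame.{0}, X.IsTransitive → X.ValidFm φ) → φ ∈ T
  mp : ∀ φ ψ : Fm, φ ∈ T → imp φ ψ ∈ T → ψ ∈ T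
  nec : ∀ φ : Fm, φ ∈ T → box φ ∈ T

namespace IsTheory

variable {T : Set Fm}

/-- `K4` is given semantically, so the laws of the Lindenbaum algebra can be checked pointwise on
frames instead of being derived. -/
theorem mem_of_sat (hT : IsTheory T) {φ : Fm}
    (h : ∀ (X : Frame.{0}), X.IsTransitive → ∀ (v : ℕ → X.Alg) (x : X.carrier), Sat v x φ) :
    φ ∈ T :=
  hT.valid φ fun X hX v => Set.eq_univ_of_forall fun x => h X hX v x

theorem mem_of_sat_one (hT : IsTheory T) {α φ : Fm} (hα : α ∈ T)
    (h : ∀ (X : Frame.{0}) (v : ℕ → X.Alg) (x : X.carrier), Sat v x α → Sat v x φ) :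
    φ ∈ T :=
  hT.mp α φ hα (hT.mem_of_sat fun X _ v x => (sat_imp v x α φ).2 (h X v x))

theorem mem_of_sat_two (hT : IsTheory T) {α β φ : Fm} (hα : α ∈ T) (hβ : β ∈ T)
    (h : ∀ (X : Frame.{0}) (v : ℕ → X.Alg) (x : X.carrier),
      Sat v x α → Sat v x β → Sat v x φ) :
    φ ∈ T :=
  hT.mp β φ hβ (hT.mem_of_sat_one hα fun X v x ha => (sat_imp v x β φ).2 (h X v x ha))

/-- Provable equivalence over a theory. -/
def setoid (hT : IsTheory T) : Setoid Fm where
  r φ ψ := imp φ ψ ∈ T ∧ imp ψ φ ∈ T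
  iseqv :=
    { refl := fun φ => ⟨hT.mem_of_sat (by simp), hT.mem_of_sat (by simp)⟩
      symm := fun h => ⟨h.2, h.1⟩
      trans := fun h k =>
        ⟨hT.mem_of_sat_two h.1 k.1 (by simp only [sat_imp]; tauto),
          hT.mem_of_sat_two h.2 k.2 (by simp only [sat_imp]; tauto)⟩ }

/-- The carrier of the Lindenbaum algebra of a theory. -/
def Lind (hT : IsTheory T) : Type := Quotient hT.setoid

/-- The class of a formula in the Lindenbaum algebra. -/
def cls (hT : IsTheory T) (φ : Fm) : hT.Lind := Quotient.mk hT.setoid φ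

theorem box_mono (hT : IsTheory T) {φ ψ : Fm} (h : imp φ ψ ∈ T) :
    imp (box φ) (box ψ) ∈ T :=
  hT.mem_of_sat_one (hT.nec _ h) (by
    simp only [sat_imp, sat_box]
    intro X v x h1 h2 y hy
    exact h1 y hy (h2 y hy))

instance (hT : IsTheory T) : PartialOrder hT.Lind where
  le := Quotient.lift₂ (s₁ := hT.setoid) (s₂ := hT.setoid) (fun φ ψ => imp φ ψ ∈ T) (by
    intro a b c d hac hbd
    refine propext ⟨fun h => ?_, fun h => ?_⟩
    · exact hT.mem_of_sat_two (hT.mem_of_sat_two hac.2 h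
        (φ := imp c b) (by simp only [sat_imp]; tauto)) hbd.1 (by simp only [sat_imp]; tauto)
    · exact hT.mem_of_sat_two (hT.mem_of_sat_two hac.1 h
        (φ := imp a d) (by simp only [sat_imp]; tauto)) hbd.2 (by simp only [sat_imp]; tauto))
  le_refl := by
    rintro ⟨φ⟩
    exact hT.mem_of_sat (φ := imp φ φ) (by simp)
  le_trans := by
    rintro ⟨φ⟩ ⟨ψ⟩ ⟨χ⟩ h k
    exact hT.mem_of_sat_two (α := imp φ ψ) (β := imp ψ χ) (φ := imp φ χ) h k
      (by simp only [sat_imp]; tauto)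
  le_antisymm := by
    rintro ⟨φ⟩ ⟨ψ⟩ h k
    exact Quotient.sound (s := hT.setoid) ⟨h, k⟩

theorem cls_le_cls (hT : IsTheory T) {φ ψ : Fm} : hT.cls φ ≤ hT.cls ψ ↔ imp φ ψ ∈ T := Iff.rfl

theorem cls_surjective (hT : IsTheory T) : Function.Surjective hT.cls :=
  Quotient.mk_surjective

instance (hT : IsTheory T) : Lattice hT.Lind where
  inf := Quotient.map₂ (sa := hT.setoid) (sb := hT.setoid) (sc := hT.setoid) Fm.and (by
    intro a b hab c d hcd
    exact ⟨hT.mem_of_sat_two hab.1 hcd.1 (by simp only [sat_imp, sat_and]; tauto),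
      hT.mem_of_sat_two hab.2 hcd.2 (by simp only [sat_imp, sat_and]; tauto)⟩)
  sup := Quotient.map₂ (sa := hT.setoid) (sb := hT.setoid) (sc := hT.setoid) Fm.or (by
    intro a b hab c d hcd
    exact ⟨hT.mem_of_sat_two hab.1 hcd.1 (by simp only [sat_imp, sat_or]; tauto),
      hT.mem_of_sat_two hab.2 hcd.2 (by simp only [sat_imp, sat_or]; tauto)⟩)
  inf_le_left := by
    rintro ⟨φ⟩ ⟨ψ⟩
    exact hT.mem_of_sat (φ := imp (Fm.and φ ψ) φ) (by simp only [sat_imp, sat_and]; tauto)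
  inf_le_right := by
    rintro ⟨φ⟩ ⟨ψ⟩
    exact hT.mem_of_sat (φ := imp (Fm.and φ ψ) ψ) (by simp only [sat_imp, sat_and]; tauto)
  le_inf := by
    rintro ⟨φ⟩ ⟨ψ⟩ ⟨χ⟩ h k
    exact hT.mem_of_sat_two (α := imp φ ψ) (β := imp φ χ) (φ := imp φ (Fm.and ψ χ)) h k
      (by simp only [sat_imp, sat_and]; tauto)
  le_sup_left := by
    rintro ⟨φ⟩ ⟨ψ⟩
    exact hT.mem_of_sat (φ := imp φ (Fm.or φ ψ)) (by simp only [sat_imp, sat_or]; tauto)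
  le_sup_right := by
    rintro ⟨φ⟩ ⟨ψ⟩
    exact hT.mem_of_sat (φ := imp ψ (Fm.or φ ψ)) (by simp only [sat_imp, sat_or]; tauto)
  sup_le := by
    rintro ⟨φ⟩ ⟨ψ⟩ ⟨χ⟩ h k
    exact hT.mem_of_sat_two (α := imp φ χ) (β := imp ψ χ) (φ := imp (Fm.or φ ψ) χ) h k
      (by simp only [sat_imp, sat_or]; tauto)

/-- The Lindenbaum algebra of a theory. -/
instance (hT : IsTheory T) : ModalAlgebra hT.Lind where
  le_sup_inf := by
    rintro ⟨φ⟩ ⟨ψ⟩ ⟨χ⟩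
    exact hT.mem_of_sat
      (φ := imp (Fm.and (Fm.or φ ψ) (Fm.or φ χ)) (Fm.or φ (Fm.and ψ χ)))
      (by simp only [sat_imp, sat_or, sat_and]; tauto)
  compl := Quotient.map (sa := hT.setoid) (sb := hT.setoid) Fm.neg (by
    intro a b hab
    exact ⟨hT.mem_of_sat_one hab.2 (by simp only [sat_imp, sat_neg]; tauto),
      hT.mem_of_sat_one hab.1 (by simp only [sat_imp, sat_neg]; tauto)⟩)
  top := hT.cls Fm.top
  bot := hT.cls Fm.bot
  inf_compl_le_bot := by
    rintro ⟨φ⟩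
    exact hT.mem_of_sat (φ := imp (Fm.and φ (neg φ)) Fm.bot)
      (by simp only [sat_imp, sat_neg, sat_and]; tauto)
  top_le_sup_compl := by
    rintro ⟨φ⟩
    exact hT.mem_of_sat (φ := imp Fm.top (Fm.or φ (neg φ)))
      (by simp only [sat_imp, sat_neg, sat_or]; tauto)
  le_top := by
    rintro ⟨φ⟩
    exact hT.mem_of_sat (φ := imp φ Fm.top) (by simp)
  bot_le := by
    rintro ⟨φ⟩
    exact hT.mem_of_sat (φ := imp Fm.bot φ) (by simp)
  box := Quotient.map (sa := hT.setoid) (sb := hT.setoid) Fm.box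
    fun _ _ hab => ⟨hT.box_mono hab.1, hT.box_mono hab.2⟩
  box_top := Quotient.sound (s := hT.setoid)
    ⟨hT.mem_of_sat (φ := imp (Fm.box Fm.top) Fm.top) (by simp),
      hT.mem_of_sat (φ := imp Fm.top (Fm.box Fm.top)) (by simp)⟩
  box_inf := by
    rintro ⟨φ⟩ ⟨ψ⟩
    refine Quotient.sound (s := hT.setoid) ⟨hT.mem_of_sat ?_, hT.mem_of_sat ?_⟩
    · simp only [sat_imp, sat_box, sat_and]
      exact fun X _ v x h => ⟨fun y hy => (h y hy).1, fun y hy => (h y hy).2⟩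
    · simp only [sat_imp, sat_box, sat_and]
      exact fun X _ v x h y hy => ⟨h.1 y hy, h.2 y hy⟩

theorem cls_eq_top (hT : IsTheory T) {φ : Fm} : hT.cls φ = ⊤ ↔ φ ∈ T := by
  refine ⟨fun h => ?_, fun h => ?_⟩
  · have h1 : hT.cls Fm.top ≤ hT.cls φ := h.ge
    exact hT.mp _ _ (hT.mem_of_sat (by simp)) (hT.cls_le_cls.1 h1)
  · refine top_le_iff.1 (hT.cls_le_cls.2 (hT.mem_of_sat_one h ?_ : imp Fm.top φ ∈ T))
    simp only [sat_imp]
    tauto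

theorem eval_cls (hT : IsTheory T) (s : ℕ → Fm) (φ : Fm) :
    eval (fun n => hT.cls (s n)) φ = hT.cls (subst s φ) := by
  induction φ with
  | var n => rfl
  | bot => rfl
  | top => rfl
  | and φ ψ h k => simp only [eval, h, k]; rfl
  | neg φ h => simp only [eval, h]; rfl
  | box φ h => simp only [eval, h]; rfl

/-- A theory closed under all substitution instances of a rule validates the rule on its
Lindenbaum algebra. -/
theorem validates_lind (hT : IsTheory T) {r : Rule}
    (h : ∀ s : ℕ → Fm, (∀ γ ∈ r.prem, subst s γ ∈ T) → ∃ δ ∈ r.concl, subst s δ ∈ T) :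
    Validates hT.Lind r := by
  intro v hv
  obtain ⟨s, rfl⟩ : ∃ s : ℕ → Fm, v = fun n => hT.cls (s n) := by
    choose s hs using fun n => hT.cls_surjective (v n)
    exact ⟨s, funext fun n => (hs n).symm⟩
  simp only [eval_cls, cls_eq_top] at hv ⊢
  exact h s hv

end IsTheory
-- Generated rule systems and their algebraic completeness
theorem subst_var (φ : Fm) : subst Fm.var φ = φ := by
  induction φ with
  | var n => rfl
  | bot => rfl
  | top => rfl
  | and φ ψ h k => simp only [subst, h, k]
  | neg φ h => simp only [subst, h]
  | box φ h => simp only [subst, h]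

theorem isRuleSystem_generated (A : Set Rule) : IsRuleSystem (generated A) where
  structural s r hr := fun S hS => hS.1.structural s r (hr S hS)
  refl φ := fun _ hS => hS.1.refl φ
  mono Γ Δ Γ' Δ' h := fun S hS => hS.1.mono Γ Δ Γ' Δ' (h S hS)
  cut Γ Δ φ h k := fun S hS => hS.1.cut Γ Δ φ (h S hS) (k S hS)
  modusPonens φ ψ := fun _ hS => hS.1.modusPonens φ ψ
  necessitation φ := fun _ hS => hS.1.necessitation φ

theorem subset_generated (A : Set Rule) : A ⊆ generated A := fun _ hr _ hS => hS.2 hr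

theorem generated_subset {A S : Set Rule} (hS : IsRuleSystem S) (h : A ⊆ S) :
    generated A ⊆ S := fun _ hr => hr S ⟨hS, h⟩

namespace IsRuleSystem

variable {S : Set Rule}

theorem weaken (hS : IsRuleSystem S) {Γ Δ Γ' Δ' : Finset Fm} (h : (⟨Γ, Δ⟩ : Rule) ∈ S)
    (hΓ : Γ ⊆ Γ') (hΔ : Δ ⊆ Δ') : (⟨Γ', Δ'⟩ : Rule) ∈ S := by
  have := hS.mono Γ Δ Γ' Δ' h
  rwa [Finset.union_eq_right.2 hΓ, Finset.union_eq_right.2 hΔ] at this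

/-- A rule outside a rule system is separated from it by a set of formulae closed under all
the rules of the system. -/
theorem exists_closed (hS : IsRuleSystem S) {r : Rule} (hr : r ∉ S) :
    ∃ T : Set Fm, (∀ γ ∈ r.prem, γ ∈ T) ∧ (∀ δ ∈ r.concl, δ ∉ T) ∧
      ∀ s ∈ S, (∀ γ ∈ s.prem, γ ∈ T) → ∃ δ ∈ s.concl, δ ∈ T := by
  -- `T` is taken maximal among the sets no finite part of which yields the conclusions of `r` in
  -- `S`; finite character provides a maximal one.
  have hF : Order.IsOfFiniteCharacter
      {T : Set Fm | ∀ Γ : Finset Fm, ↑Γ ⊆ T → (⟨Γ, r.concl⟩ : Rule) ∉ S} := by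
    refine fun T => ⟨fun h T' hT' _ Γ hΓ => h Γ (hΓ.trans hT'), fun h Γ hΓ => ?_⟩
    exact h Γ hΓ Γ.finite_toSet Γ subset_rfl
  obtain ⟨T, hrT, hT⟩ := hF.exists_maximal (x := (↑r.prem : Set Fm))
    fun Γ hΓ h => hr (hS.weaken h (Finset.coe_subset.1 hΓ) subset_rfl)
  have hTF := hT.prop
  have key : ∀ ψ, ψ ∉ T → ∃ Γ : Finset Fm, ↑Γ ⊆ T ∧ (⟨Γ ∪ {ψ}, r.concl⟩ : Rule) ∈ S := by
    intro ψ hψ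
    by_contra! hcon
    refine hψ (hT.le_of_ge (y := insert ψ T) ?_ (Set.subset_insert _ _) (Set.mem_insert _ _))
    intro Γ hΓ hmem
    refine hcon (Γ.erase ψ) (fun γ hγ => ?_) (hS.weaken hmem (fun γ hγ => ?_) subset_rfl)
    · have hγ' := Finset.mem_erase.1 (Finset.mem_coe.1 hγ)
      exact (hΓ hγ'.2).resolve_left hγ'.1
    · by_cases h : γ = ψ <;> simp [h, hγ]
  -- By maximality each formula outside `T` can be cut away, so a rule of `S` leading from `T` to
  -- its complement would contradict the choice of `T`.
  have cuts : ∀ Δ Γ : Finset Fm, ↑Γ ⊆ T → (∀ δ ∈ Δ, δ ∉ T) →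
      (⟨Γ, r.concl ∪ Δ⟩ : Rule) ∉ S := by
    intro Δ
    induction Δ using Finset.induction_on with
    | empty => exact fun Γ hΓ _ h => hTF Γ hΓ (by simpa using h)
    | insert ψ Δ _ ih =>
      intro Γ hΓ hΔ h
      obtain ⟨Γ', hΓ', h'⟩ := key ψ (hΔ ψ (Finset.mem_insert_self _ _))
      refine ih (Γ ∪ Γ') (by simp [hΓ, hΓ'])
        (fun δ hδ => hΔ δ (Finset.mem_insert_of_mem hδ)) (hS.cut _ _ ψ ?_ ?_)
      · refine hS.weaken h Finset.subset_union_left fun δ hδ => ?_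
        simp only [Finset.mem_union, Finset.mem_insert, Finset.mem_singleton] at hδ ⊢
        tauto
      · refine hS.weaken h' (fun γ hγ => ?_) Finset.subset_union_left
        simp only [Finset.mem_union, Finset.mem_singleton] at hγ ⊢
        tauto
  refine ⟨T, fun γ hγ => hrT hγ, fun δ hδ hδT => ?_, fun s hs hprem => ?_⟩
  · exact hTF {δ} (by simpa using hδT)
      (hS.weaken (hS.refl δ) subset_rfl (Finset.singleton_subset_iff.2 hδ))
  · by_contra! hcon
    exact cuts s.concl s.prem hprem hcon (hS.weaken hs subset_rfl Finset.subset_union_right)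

/-- Completeness of rule systems above `K4` with respect to modal algebras. -/
theorem exists_refuting (hS : IsRuleSystem S) (hK : systemK4 ⊆ S) {r : Rule} (hr : r ∉ S) :
    ∃ (M : Type) (_ : ModalAlgebra M), (∀ s ∈ S, Validates M s) ∧ ¬ Validates M r := by
  obtain ⟨T, hprem, hconcl, hclosed⟩ := hS.exists_closed hr
  have hT : IsTheory T :=
    { valid := fun φ h => by
        have := hclosed ⟨∅, {φ}⟩ (hK (subset_generated _ ⟨φ, h, rfl⟩)) (by simp)
        simpa using this
      mp := fun φ ψ h k => by
        have := hclosed _ (hS.modusPonens φ ψ) (by simp [h, k])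
        simpa using this
      nec := fun φ h => by
        have := hclosed _ (hS.necessitation φ) (by simp [h])
        simpa using this }
  refine ⟨hT.Lind, inferInstance, fun s hs => hT.validates_lind fun σ h => ?_, fun h => ?_⟩
  · have := hclosed _ (hS.structural σ s hs) (by simpa using h)
    simpa using this
  · obtain ⟨δ, hδ, hδ'⟩ := h (fun n => hT.cls (var n)) fun γ hγ => by
      rw [hT.eval_cls, subst_var, hT.cls_eq_top]
      exact hprem γ hγ
    rw [hT.eval_cls, subst_var, hT.cls_eq_top] at hδ'
    exact hconcl δ hδ hδ'

end IsRuleSystem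

/-! ### Evaluation of the defined connectives -/

section Eval

variable {M : Type u} [ModalAlgebra M] (v : ℕ → M) (φ ψ : Fm)

theorem eval_imp : eval v (imp φ ψ) = eval v φ ⇨ eval v ψ := by
  simp [imp, eval, himp_eq, sup_comm]

theorem eval_imp_eq_top : eval v (imp φ ψ) = ⊤ ↔ eval v φ ≤ eval v ψ := by
  rw [eval_imp, himp_eq_top_iff]

theorem eval_iff_eq_top : eval v (Fm.iff φ ψ) = ⊤ ↔ eval v φ = eval v ψ := by
  rw [Fm.iff, eval, inf_eq_top_iff, eval_imp_eq_top, eval_imp_eq_top]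
  exact ⟨fun h => le_antisymm h.1 h.2, fun h => ⟨h.le, h.ge⟩⟩

theorem eval_boxPlus : eval v (Fm.boxPlus φ) = boxPlus (eval v φ) := rfl

end Eval

/-- An algebra validating the rules of `GL` is a Magari algebra. -/
theorem isMagari_of_validates {M : Type u} [ModalAlgebra M]
    (h : ∀ r ∈ systemGL, Validates M r) : IsMagari M := by
  constructor
  · intro a
    have h4 : (⟨∅, {imp (box (var 0)) (box (box (var 0)))}⟩ : Rule) ∈ systemGL := by
      refine subset_generated _ (Or.inl (subset_generated _ ⟨_, fun X hX v => ?_, rfl⟩))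
      refine Set.eq_univ_of_forall fun x =>
        (sat_imp v x (box (var 0)) (box (box (var 0)))).2 fun hx y hxy z hyz =>
          (sat_box v x (var 0)).1 hx z (hX x y z hxy hyz)
    have := h _ h4 (fun _ => a) (by simp)
    simpa [eval_imp_eq_top, eval] using this
  · intro a
    have := h loebRule (subset_generated _ (Or.inr rfl)) (fun _ => a) (by simp [loebRule])
    simpa [loebRule, eval_imp_eq_top, eval_imp, eval] using this

/-- Sets of rules valid on the same Magari algebras axiomatize the same extension of `GL`. -/
theorem extend_subset_extend {A B : Set Rule}
    (h : ∀ (M : Type) [ModalAlgebra M], IsMagari M → (∀ s ∈ B, Validates M s) →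
      ∀ r ∈ A, Validates M r) :
    extend systemGL A ⊆ extend systemGL B := by
  have hB : IsRuleSystem (extend systemGL B) := isRuleSystem_generated _
  have hGL : systemGL ⊆ extend systemGL B :=
    Set.subset_union_left.trans (subset_generated _)
  refine generated_subset hB (Set.union_subset hGL fun r hr => ?_)
  by_contra hcon
  obtain ⟨M, _, hM, hMr⟩ := hB.exists_refuting
    ((Set.subset_union_left.trans (subset_generated _)).trans hGL) hcon
  exact hMr (h M (isMagari_of_validates fun s hs => hM s (hGL hs))
    (fun s hs => hM s (subset_generated _ (Or.inr hs))) r hr)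

/-! ### Points of a modal algebra -/

/-- The points of the dual space of a modal algebra: its ultrafilters. -/
structure Point (M : Type u) [ModalAlgebra M] where
  carrier : Set M
  top_mem' : ⊤ ∈ carrier
  inf_mem_iff' : ∀ a b, a ⊓ b ∈ carrier ↔ a ∈ carrier ∧ b ∈ carrier
  compl_mem_iff' : ∀ a, aᶜ ∈ carrier ↔ a ∉ carrier

namespace Point

variable {M : Type u} [ModalAlgebra M]

instance : Membership M (Point M) := ⟨fun x a => a ∈ x.carrier⟩

variable (x y z : Point M) (a b : M)

@[simp] theorem top_mem : ⊤ ∈ x := x.top_mem'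

@[simp] theorem inf_mem_iff : a ⊓ b ∈ x ↔ a ∈ x ∧ b ∈ x := x.inf_mem_iff' a b

@[simp] theorem compl_mem_iff : aᶜ ∈ x ↔ a ∉ x := x.compl_mem_iff' a

@[simp] theorem bot_notMem : ⊥ ∉ x := by
  rw [← compl_mem_iff, compl_bot]
  exact x.top_mem

variable {x y z a b}

theorem mem_of_le (h : a ≤ b) (ha : a ∈ x) : b ∈ x := by
  rw [← inf_eq_left.2 h] at ha
  exact ((inf_mem_iff x a b).1 ha).2

/-- The prime ideal theorem for the filter `G` and the principal ideal of `a`: in a Boolean algebra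
the complement of a prime ideal is an ultrafilter. -/
theorem exists_notMem {G : Set M} (top : ⊤ ∈ G) (inf : ∀ b ∈ G, ∀ c ∈ G, b ⊓ c ∈ G)
    (up : ∀ b c, b ≤ c → b ∈ G → c ∈ G) (ha : a ∉ G) :
    ∃ x : Point M, (∀ b ∈ G, b ∈ x) ∧ a ∉ x := by
  have hG : Order.IsPFilter G := Order.IsPFilter.of_def ⟨⊤, top⟩
    (fun b hb c hc => ⟨b ⊓ c, inf b hb c hc, inf_le_left, inf_le_right⟩)
    (fun {b c} hbc hb => up b c hbc hb)
  obtain ⟨J, hJ, haJ, hGJ⟩ := DistribLattice.prime_ideal_of_disjoint_filter_ideal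
    (F := hG.toPFilter) (I := Order.Ideal.principal a)
    (Set.disjoint_left.2 fun b hb hba => ha (up b a hba hb))
  have htop : (⊤ : M) ∉ J := fun h => Set.disjoint_left.1 hGJ top h
  refine ⟨⟨(J : Set M)ᶜ, htop, fun b c => ?_, fun b => ?_⟩, fun b hb => ?_, fun h => ?_⟩
  · refine ⟨fun h => ⟨fun hb => h (J.lower inf_le_left hb), fun hc =>
      h (J.lower inf_le_right hc)⟩, fun h hbc => ?_⟩
    exact (hJ.mem_or_mem hbc).elim h.1 h.2
  · refine ⟨fun h hb => ?_, fun h hb => ?_⟩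
    · exact hb ((hJ.mem_or_compl_mem (x := b)).resolve_right h)
    · exact htop (by simpa using J.sup_mem (not_not.1 h) hb)
  · exact fun h => Set.disjoint_left.1 hGJ hb h
  · exact h (haJ (Order.Ideal.mem_principal_self (x := a)))

theorem le_of_forall_mem (h : ∀ x : Point M, a ∈ x → b ∈ x) : a ≤ b := by
  by_contra hab
  obtain ⟨x, hx, hb⟩ := exists_notMem (G := {c | a ≤ c}) (a := b) le_top
    (fun _ h _ k => le_inf h k) (fun _ _ h k => le_trans k h) hab
  exact hb (h x (hx a le_rfl))

theorem eq_of_forall_mem_iff (h : ∀ x : Point M, a ∈ x ↔ b ∈ x) : a = b :=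
  le_antisymm (le_of_forall_mem fun x => (h x).1) (le_of_forall_mem fun x => (h x).2)

theorem exists_notMem_of_ne_top (h : a ≠ ⊤) : ∃ x : Point M, a ∉ x := by
  by_contra! hcon
  exact h (eq_of_forall_mem_iff fun x => ⟨fun _ => x.top_mem, fun _ => hcon x⟩)

/-- The accessibility relation of the dual space. -/
def Acc (x y : Point M) : Prop := ∀ a, ModalAlgebra.box a ∈ x → a ∈ y

theorem _root_.GLRules.box_mono {a b : M} (h : a ≤ b) :
    ModalAlgebra.box a ≤ ModalAlgebra.box b := by
  rw [← inf_eq_left, ← ModalAlgebra.box_inf, inf_eq_left.2 h]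

/-- The elements whose box lies in `x` form a filter; if `a` is not among them, some ultrafilter
extends this filter and omits `a`. -/
theorem box_mem_iff : ModalAlgebra.box a ∈ x ↔ ∀ y, x.Acc y → a ∈ y := by
  refine ⟨fun h y hxy => hxy a h, fun h => ?_⟩
  by_contra ha
  obtain ⟨y, hy, hay⟩ := exists_notMem (G := {c | ModalAlgebra.box c ∈ x}) (a := a)
    (by simp [ModalAlgebra.box_top]) (fun b hb c hc => by simp_all [ModalAlgebra.box_inf])
    (fun b c hbc hb => mem_of_le (box_mono hbc) hb) ha
  exact hay (h y hy)

theorem Acc.trans (hM : IsMagari M) (h : x.Acc y) (k : y.Acc z) : x.Acc z :=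
  fun a ha => k a (h _ (mem_of_le (hM.1 a) ha))

/-- Löb's axiom read contrapositively. It replaces converse well-foundedness, which the dual space
may lack: a definable failure above `x` has a last occurrence. -/
theorem exists_acc_of_box_notMem (hM : IsMagari M) (h : ModalAlgebra.box a ∉ x) :
    ∃ y, x.Acc y ∧ a ∉ y ∧ ModalAlgebra.box a ∈ y := by
  have h' : ModalAlgebra.box (ModalAlgebra.box a ⇨ a) ∉ x := fun k => h (mem_of_le (hM.2 a) k)
  rw [box_mem_iff] at h'
  push Not at h'
  obtain ⟨y, hxy, hy⟩ := h'
  refine ⟨y, hxy, fun k => hy (mem_of_le le_himp k), ?_⟩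
  by_contra k
  rw [← compl_mem_iff] at k
  exact hy (mem_of_le (le_sup_right.trans himp_eq.ge) k)

/-! ### Definable sets of points and definable maps to finite sets -/

/-- Sets of points that are given by an element of the algebra. -/
def Definable (U : Set (Point M)) : Prop := ∃ a : M, ∀ x, x ∈ U ↔ a ∈ x

variable {U V : Set (Point M)}

theorem definable_const (p : Prop) : Definable {_x : Point M | p} := by
  by_cases h : p
  · exact ⟨⊤, by simp [h]⟩
  · exact ⟨⊥, by simp [h]⟩

theorem Definable.compl (hU : Definable U) : Definable Uᶜ := by
  obtain ⟨a, ha⟩ := hU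
  exact ⟨aᶜ, by simp [ha]⟩

theorem Definable.inter (hU : Definable U) (hV : Definable V) : Definable (U ∩ V) := by
  obtain ⟨a, ha⟩ := hU
  obtain ⟨b, hb⟩ := hV
  exact ⟨a ⊓ b, by simp [ha, hb]⟩

theorem Definable.union (hU : Definable U) (hV : Definable V) : Definable (U ∪ V) := by
  have := (hU.compl.inter hV.compl).compl
  rwa [Set.compl_inter, compl_compl, compl_compl] at this

theorem Definable.box (hU : Definable U) : Definable {x | ∀ y, x.Acc y → y ∈ U} := by
  obtain ⟨a, ha⟩ := hU
  exact ⟨ModalAlgebra.box a, by simp [ha, box_mem_iff]⟩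

theorem Definable.dia (hU : Definable U) : Definable {x | ∃ y, x.Acc y ∧ y ∈ U} := by
  convert hU.compl.box.compl using 1
  ext x
  simp

theorem Definable.iUnion {ι : Type*} [Finite ι] {U : ι → Set (Point M)}
    (h : ∀ i, Definable (U i)) : Definable (⋃ i, U i) := by
  have := Fintype.ofFinite ι
  have key : ∀ s : Finset ι, Definable (⋃ i ∈ s, U i) := by
    intro s
    classical
    induction s using Finset.induction_on with
    | empty => simpa using definable_const (M := M) False
    | insert i s _ ih =>
      rw [Finset.set_biUnion_insert]
      exact (h i).union ih
  simpa using key Finset.univ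

theorem Definable.iInter {ι : Type*} [Finite ι] {U : ι → Set (Point M)}
    (h : ∀ i, Definable (U i)) : Definable (⋂ i, U i) := by
  have := (Definable.iUnion fun i => (h i).compl).compl
  simpa using this

/-- Functions on points all of whose preimages are definable. -/
def DefinableFun {β : Type*} (g : Point M → β) : Prop := ∀ P : Set β, Definable (g ⁻¹' P)

theorem DefinableFun.comp {β γ : Type*} {f : Point M → β} (hf : DefinableFun f) (k : β → γ) :
    DefinableFun fun x => k (f x) := fun P => hf (k ⁻¹' P)

section DefinableFun

variable {β γ : Type*} [Finite β] [Finite γ]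

theorem definableFun_of_fibers {g : Point M → β} (h : ∀ b, Definable {x | g x = b}) :
    DefinableFun g := by
  intro P
  convert Definable.iUnion fun b => (h b).inter (definable_const (b ∈ P)) using 1
  ext x
  simp

theorem definableFun_set {g : Point M → Set β} (h : ∀ b, Definable {x | b ∈ g x}) :
    DefinableFun g := by
  refine definableFun_of_fibers fun S => ?_
  convert Definable.iInter fun b => (((h b).inter (definable_const (b ∈ S))).union
    ((h b).compl.inter (definable_const (b ∉ S)))) using 1
  ext x
  simp only [Set.mem_ofPred_eq, Set.mem_iInter, Set.mem_union, Set.mem_inter_iff,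
    Set.mem_compl_iff, Set.ext_iff]
  exact forall_congr' fun b => by tauto

theorem definableFun_prop {p : Point M → Prop} (h : Definable {x | p x}) : DefinableFun p := by
  refine definableFun_of_fibers fun q => ?_
  by_cases hq : q
  · simpa [hq] using h
  · convert h.compl using 1
    ext x
    simp [hq]

theorem DefinableFun.prodMk {f : Point M → β} {g : Point M → γ} (hf : DefinableFun f)
    (hg : DefinableFun g) : DefinableFun fun x => (f x, g x) := by
  refine definableFun_of_fibers fun p => ?_
  convert (hf {p.1}).inter (hg {p.2}) using 1
  ext x
  simp [Prod.ext_iff]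

end DefinableFun

end Point

/-! ### Validity of pre-stable canonical rules -/

/-- Boolean embeddings of the dual algebra of a frame that are stable for `□⁺` and preserve
`□` on the complements of the members of the domain. -/
structure IsPreStableEmbedding {M : Type u} [ModalAlgebra M] (X : Frame.{0})
    (D : Finset (Set X.carrier)) (h : X.Alg → M) : Prop where
  map_bot : h ⊥ = ⊥
  map_top : h ⊤ = ⊤
  map_inf : ∀ a b, h (a ⊓ b) = h a ⊓ h b
  map_compl : ∀ a, h aᶜ = (h a)ᶜ
  map_boxPlus : ∀ a, h (boxPlus a) ≤ boxPlus (h a)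
  map_box : ∀ a : X.Alg, aᶜ ∈ D → h (ModalAlgebra.box a) = ModalAlgebra.box (h a)
  ne_top : ∀ a, a ≠ ⊤ → h a ≠ ⊤

/-- A refuting valuation, read as `a ↦ v (p a)`, is exactly such an embedding; injectivity of `p`
lets every map `X.Alg → M` arise from a valuation. -/
theorem not_validates_framePreStableRule_iff {M : Type u} [ModalAlgebra M] {X : Frame.{0}}
    [Finite X.carrier] {D : Finset (Set X.carrier)} {p : X.Alg → ℕ}
    (hp : Function.Injective p) :
    ¬ Validates M (framePreStableRule X D p) ↔
      ∃ h : X.Alg → M, IsPreStableEmbedding X D h := by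
  classical
  have key : ∀ v : ℕ → M, ((∀ γ ∈ (framePreStableRule X D p).prem, eval v γ = ⊤) ∧
      ∀ δ ∈ (framePreStableRule X D p).concl, eval v δ ≠ ⊤) ↔
      IsPreStableEmbedding X D fun a => v (p a) := by
    intro v
    have hD : ∀ a : X.Alg, (∃ d ∈ D, (dᶜ : Set X.carrier) = a) ↔ aᶜ ∈ D := by
      intro a
      constructor
      · rintro ⟨d, hd, rfl⟩
        exact (compl_compl d).symm ▸ hd
      · intro h
        exact ⟨_, h, compl_compl (a : Set X.carrier)⟩
    simp only [framePreStableRule, preStableRule, Finset.mem_union, Finset.mem_image,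
      Finset.mem_singleton, Finset.mem_univ, true_and, or_imp, forall_and, forall_eq,
      forall_exists_index, forall_apply_eq_imp_iff, eval_iff_eq_top, eval_imp_eq_top,
      eval_boxPlus, eval, and_imp, Finset.mem_filter, forall_apply_eq_imp_iff₂, Prod.forall]
    constructor
    · rintro ⟨⟨⟨⟨⟨⟨h1, h2⟩, h3⟩, h4⟩, h5⟩, h6⟩, h7⟩
      exact ⟨h1, h2, fun a b => (eval_iff_eq_top v _ _).1 (h3 _ a b rfl), h4, h5,
        fun a ha => h6 a (Finset.mem_image.2 ((hD a).2 ha)), h7⟩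
    · rintro ⟨h1, h2, h3, h4, h5, h6, h7⟩
      refine ⟨⟨⟨⟨⟨⟨h1, h2⟩, ?_⟩, h4⟩, h5⟩,
        fun a ha => h6 a ((hD a).1 (Finset.mem_image.1 ha))⟩, h7⟩
      rintro _ a b rfl
      exact (eval_iff_eq_top v _ _).2 (h3 a b)
  constructor
  · intro h
    unfold Validates at h
    push Not at h
    obtain ⟨v, hv⟩ := h
    exact ⟨_, (key v).1 hv⟩
  · rintro ⟨h, hh⟩ hval
    have hv : (fun a => Function.extend p h (fun _ => ⊥) (p a)) = h :=
      funext fun a => hp.extend_apply h _ a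
    have := (key (Function.extend p h fun _ => ⊥)).2 (by rwa [hv])
    obtain ⟨δ, hδ, hδ'⟩ := hval _ this.1
    exact this.2 δ hδ hδ'

/-- Uniqueness of a modal fixed point. From `b = □b ∧ □a` one gets `□a ≤ □b → b`, hence `□a ≤ □□a ≤
□(□b → b) ≤ □b`, and so `□a ≤ b`. -/
theorem IsMagari.box_eq_of_eq_box_inf {M : Type u} [ModalAlgebra M] (hM : IsMagari M)
    {a b : M} (h : b = ModalAlgebra.box (b ⊓ a)) : b = ModalAlgebra.box a := by
  have hb : b = ModalAlgebra.box b ⊓ ModalAlgebra.box a := by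
    rw [← ModalAlgebra.box_inf]
    exact h
  refine le_antisymm (hb.le.trans inf_le_right) ?_
  have h1 : ModalAlgebra.box a ≤ ModalAlgebra.box b ⇨ b := by
    rw [le_himp_iff, inf_comm]
    exact hb.ge
  have h2 : ModalAlgebra.box a ≤ ModalAlgebra.box b :=
    ((hM.1 a).trans (box_mono h1)).trans (hM.2 b)
  exact (le_inf h2 le_rfl).trans hb.ge

/-- A rule refuted on a `K4`-frame under a valuation whose relevant `□⁺`-formulae belong to
the domain is refuted on every Magari algebra with a pre-stable embedding of the frame. -/
theorem not_validates_of_isPreStableEmbedding {M : Type u} [ModalAlgebra M] (hM : IsMagari M)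
    {X : Frame.{0}} (hX : IsK4Algebra X.Alg) {D : Finset (Set X.carrier)} {h : X.Alg → M}
    (hh : IsPreStableEmbedding X D h) {Θ : Finset Fm}
    (hand : ∀ φ ψ, Fm.and φ ψ ∈ Θ → φ ∈ Θ ∧ ψ ∈ Θ) (hneg : ∀ φ, neg φ ∈ Θ → φ ∈ Θ)
    (hbox : ∀ φ, box φ ∈ Θ → φ ∈ Θ) {V : ℕ → X.Alg}
    (hV : ∀ φ, box φ ∈ Θ → (boxPlus (eval V φ))ᶜ ∈ D) {r : Rule} (hprem : r.prem ⊆ Θ)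
    (hconcl : r.concl ⊆ Θ) (h1 : ∀ γ ∈ r.prem, eval V γ = ⊤)
    (h2 : ∀ δ ∈ r.concl, eval V δ ≠ ⊤) : ¬ Validates M r := by
  have key : ∀ φ ∈ Θ, eval (fun n => h (V n)) φ = h (eval V φ) := by
    intro φ
    induction φ with
    | var n => exact fun _ => rfl
    | bot => exact fun _ => hh.map_bot.symm
    | top => exact fun _ => hh.map_top.symm
    | and φ ψ hφ hψ =>
      intro hΘ
      simp only [eval, hφ (hand _ _ hΘ).1, hψ (hand _ _ hΘ).2, hh.map_inf]
    | neg φ hφ =>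
      intro hΘ
      simp only [eval, hφ (hneg _ hΘ), hh.map_compl]
    | box φ hφ =>
      intro hΘ
      simp only [eval, hφ (hbox _ hΘ)]
      -- In a transitive frame `□□⁺U = □U`, so preservation of `□` at `□⁺U` becomes `h(□U) = □(h(□U)
      -- ∧ h U)`.
      refine (hM.box_eq_of_eq_box_inf ?_).symm
      have h3 := hh.map_box _ (hV φ hΘ)
      rw [boxPlus, hh.map_inf] at h3
      rw [← h3, ModalAlgebra.box_inf, inf_eq_right.2 (hX _)]
  intro hval
  obtain ⟨δ, hδ, hδ'⟩ := hval (fun n => h (V n)) fun γ hγ => by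
    rw [key γ (hprem hγ), h1 γ hγ, hh.map_top]
  rw [key δ (hconcl hδ)] at hδ'
  exact hh.ne_top _ (h2 δ hδ) hδ'

/-! ### Collapsing a Magari algebra to a finite frame of coloured points -/

/-- Colours: sets of formulae from a given finite set. -/
abbrev Color (Θ : Finset Fm) : Type := Set {φ // φ ∈ Θ}

/-- A strict bound for the ranks of points. -/
noncomputable def rankBound (Θ : Finset Fm) : ℕ := 2 * Nat.card (Color Θ) + 2

/-- Colours together with a rank. -/
abbrev RankedColor (Θ : Finset Fm) : Type := Color Θ × Fin (rankBound Θ)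

/-- The frame on a set of ranked colours in which the rank decreases and boxed formulae are
respected. -/
def colorFrame (Θ : Finset Fm) (s : Set (RankedColor Θ)) : Frame.{0} where
  carrier := s
  rel p q := q.1.2 < p.1.2 ∧ ∀ φ ψ : {φ // φ ∈ Θ}, φ.1 = box ψ.1 → φ ∈ p.1.1 →
    φ ∈ q.1.1 ∧ ψ ∈ q.1.1

section ColorFrame

variable (Θ : Finset Fm) (s : Set (RankedColor Θ))

instance : Finite (colorFrame Θ s).carrier := inferInstanceAs (Finite s)

theorem colorFrame_isTransitive : (colorFrame Θ s).IsTransitive := fun _ _ _ h k =>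
  ⟨k.1.trans h.1, fun φ ψ e hφ => k.2 φ ψ e (h.2 φ ψ e hφ).1⟩

theorem colorFrame_isSkeletal : (colorFrame Θ s).IsSkeletal := fun _ _ h k =>
  (lt_asymm h.1 k.1).elim

/-- Ranks drop strictly along the relation, so Löb's axiom follows by induction on the rank of the
successor. -/
theorem colorFrame_isGL : (colorFrame Θ s).IsGL := by
  refine ⟨fun U x hx y hxy z hyz => hx z (colorFrame_isTransitive Θ s x y z hxy hyz), ?_⟩
  intro U x hx
  have key : ∀ n : Fin (rankBound Θ), ∀ y : (colorFrame Θ s).carrier, y.1.2 = n →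
      (colorFrame Θ s).rel x y → y ∈ U := by
    intro n
    induction n using WellFoundedLT.induction with
    | ind n ih =>
      rintro y rfl hxy
      have hy : y ∈ ModalAlgebra.box U ⇨ U := hx y hxy
      rw [himp_eq] at hy
      refine hy.resolve_right fun hn => hn fun z hyz => ?_
      exact ih z.1.2 hyz.1 z rfl (colorFrame_isTransitive Θ s x y z hxy hyz)
  exact fun y hxy => key _ y rfl hxy

/-- This is why the domain is built from `□⁺φ` rather than `φ`: in a transitive frame `□⁺U` is
closed under successors. -/
theorem isDownset_compl_boxPlus {X : Frame.{u}} (hX : X.IsTransitive) (U : X.Alg) :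
    X.IsDownset (boxPlus U : X.Alg)ᶜ := fun x y hxy hy hx =>
  hy ⟨fun z hyz => hx.1 z (hX x y z hxy hyz), hx.1 y hxy⟩

/-- The valuation on a coloured frame given by the colours. -/
def colorVal : ℕ → (colorFrame Θ s).Alg := fun n =>
  {p : s | ∃ h : var n ∈ Θ, (⟨var n, h⟩ : {φ // φ ∈ Θ}) ∈ p.1.1}

end ColorFrame

/-! ### Visible colours, final points and the collapse of a point -/

namespace Point

variable {M : Type u} [ModalAlgebra M] (v : ℕ → M) (Θ : Finset Fm)

/-- The colour of a point: the formulae true at it. -/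
def color (x : Point M) : Color Θ := {φ | eval v φ.1 ∈ x}

/-- The colours that occur at or above a point. -/
def vis (x : Point M) : Set (Color Θ) := {c | ∃ y, (y = x ∨ x.Acc y) ∧ y.color v Θ = c}

/-- Points above which strictly fewer colours occur. -/
def IsFinal (x : Point M) : Prop := ∀ y, x.Acc y → y.vis v Θ ≠ x.vis v Θ

/-- Members of a set of colours whose boxed formulae belong to all its members. -/
def BoxMinimal {Θ : Finset Fm} (S : Set (Color Θ)) (c : Color Θ) : Prop :=
  c ∈ S ∧ ∀ φ : {φ // φ ∈ Θ}, (∃ ψ, φ.1 = Fm.box ψ) → φ ∈ c → ∀ d ∈ S, φ ∈ d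

open Classical in
/-- The colour of the collapse of a point with given visible colours and colour. -/
noncomputable def collapseColor {Θ : Finset Fm} (d : Set (Color Θ) × Color Θ × Prop) :
    Color Θ :=
  if d.2.2 then d.2.1 else Classical.epsilon (BoxMinimal d.1)

open Classical in
/-- The rank of the collapse of a point with given visible colours. -/
noncomputable def collapseRank {Θ : Finset Fm} (d : Set (Color Θ) × Color Θ × Prop) : ℕ :=
  2 * d.1.ncard + if d.2.2 then 0 else 1

theorem collapseRank_bounds {Θ : Finset Fm} (d : Set (Color Θ) × Color Θ × Prop) :
    2 * d.1.ncard ≤ collapseRank d ∧ collapseRank d ≤ 2 * d.1.ncard + 1 := by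
  unfold collapseRank
  split <;> omega

theorem collapseRank_lt {Θ : Finset Fm} (d : Set (Color Θ) × Color Θ × Prop) :
    collapseRank d < rankBound Θ := by
  -- Ranks are at most twice the number of colours plus one, hence the `+ 2` in `rankBound`.
  have h := Set.ncard_le_card d.1
  have h' := (collapseRank_bounds d).2
  unfold rankBound
  omega

/-- The ranked colour determined by the data of a point. -/
noncomputable def collapseData {Θ : Finset Fm} (d : Set (Color Θ) × Color Θ × Prop) :
    RankedColor Θ :=
  (collapseColor d, ⟨collapseRank d, collapseRank_lt d⟩)

/-- The data that determine the collapse of a point. -/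
def data (x : Point M) : Set (Color Θ) × Color Θ × Prop :=
  (x.vis v Θ, x.color v Θ, x.IsFinal v Θ)

/-- The ranked colour to which a point is collapsed. -/
noncomputable def collapse (x : Point M) : RankedColor Θ := collapseData (x.data v Θ)

variable {v Θ} {x y z : Point M}

theorem color_mem_vis (x : Point M) : x.color v Θ ∈ x.vis v Θ := ⟨x, Or.inl rfl, rfl⟩

theorem vis_subset (hM : IsMagari M) (h : x.Acc y) : y.vis v Θ ⊆ x.vis v Θ := by
  rintro c ⟨z, rfl | hz, rfl⟩
  · exact ⟨z, Or.inr h, rfl⟩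
  · exact ⟨z, Or.inr (h.trans hM hz), rfl⟩

theorem boxMinimal_color (hM : IsMagari M) (x : Point M) :
    BoxMinimal (x.vis v Θ) (x.color v Θ) := by
  refine ⟨color_mem_vis x, ?_⟩
  rintro ⟨_, hφ⟩ ⟨ψ, rfl⟩ hx d ⟨y, rfl | hy, rfl⟩
  · exact hx
  · exact hy _ (mem_of_le (hM.1 _) hx)

theorem boxMinimal_collapse (hM : IsMagari M) (x : Point M) :
    BoxMinimal (x.vis v Θ) (x.collapse v Θ).1 := by
  by_cases h : x.IsFinal v Θ
  · simpa [collapse, collapseData, collapseColor, data, h] using boxMinimal_color hM x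
  · simpa [collapse, collapseData, collapseColor, data, h] using
      Classical.epsilon_spec ⟨_, boxMinimal_color hM x⟩

/-- The new colour is borrowed from a genuine point, so it respects the Boolean connectives. -/
theorem exists_color_eq_collapse (hM : IsMagari M) (x : Point M) :
    ∃ y, (y = x ∨ x.Acc y) ∧ y.color v Θ = (x.collapse v Θ).1 := (boxMinimal_collapse hM x).1

/-- The old and the new colour are both box-minimal in the same visible set, so they contain the
same boxed formulae. -/
theorem box_mem_collapse_iff (hM : IsMagari M) {ψ : Fm} (h : Fm.box ψ ∈ Θ) :
    ⟨Fm.box ψ, h⟩ ∈ (x.collapse v Θ).1 ↔ ModalAlgebra.box (eval v ψ) ∈ x :=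
  ⟨fun hx => (boxMinimal_collapse hM x).2 _ ⟨ψ, rfl⟩ hx _ (color_mem_vis x),
    fun hx => (boxMinimal_color hM x).2 _ ⟨ψ, rfl⟩ hx _ (boxMinimal_collapse hM x).1⟩

theorem collapse_of_isFinal (h : x.IsFinal v Θ) : (x.collapse v Θ).1 = x.color v Θ := by
  simp [collapse, collapseData, collapseColor, data, h]

/-- Boxed formulae true at the collapse of a point are respected along accessibility. -/
theorem collapse_of_acc (hM : IsMagari M) (h : x.Acc y) {φ ψ : {φ // φ ∈ Θ}}
    (e : φ.1 = Fm.box ψ.1) (hφ : φ ∈ (x.collapse v Θ).1) :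
    φ ∈ (y.collapse v Θ).1 ∧ ψ ∈ (y.collapse v Θ).1 := by
  obtain ⟨φ, hφΘ⟩ := φ
  subst e
  rw [box_mem_collapse_iff hM] at hφ
  obtain ⟨z, hz, hzy⟩ := exists_color_eq_collapse hM y (v := v) (Θ := Θ)
  have hxz : x.Acc z := by
    rcases hz with rfl | hz
    · exact h
    · exact h.trans hM hz
  rw [box_mem_collapse_iff hM, ← hzy]
  exact ⟨h _ (mem_of_le (hM.1 _) hφ), hxz _ hφ⟩

/-- If the visible sets agree, `x` is not final: either `y` is final and the rank drops by one, or
both are non-final and merge, since the chosen colour depends only on the visible set. If a colour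
is lost, the factor `2` in the rank outweighs the extra `1`. -/
theorem collapse_eq_or_lt (hM : IsMagari M) (h : x.Acc y) :
    y.collapse v Θ = x.collapse v Θ ∨ (y.collapse v Θ).2 < (x.collapse v Θ).2 := by
  classical
  by_cases hS : y.vis v Θ = x.vis v Θ
  · have hx : ¬ x.IsFinal v Θ := fun hx => hx y h hS
    by_cases hy : y.IsFinal v Θ
    · right
      simp [collapse, collapseData, collapseRank, data, hx, hy, hS, Fin.lt_def]
    · left
      simp [collapse, collapseData, collapseRank, collapseColor, data, hx, hy, hS]
  · right
    have hlt := Set.ncard_lt_ncard ((vis_subset hM h).ssubset_of_ne hS)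
    have hx : 2 * (x.vis v Θ).ncard ≤ _ := (collapseRank_bounds (x.data v Θ)).1
    have hy : _ ≤ 2 * (y.vis v Θ).ncard + 1 := (collapseRank_bounds (y.data v Θ)).2
    simp only [collapse, collapseData, Fin.lt_def]
    omega

theorem definableFun_color : DefinableFun (M := M) (color v Θ) :=
  definableFun_set fun φ => ⟨eval v φ.1, fun _ => Iff.rfl⟩

theorem definableFun_vis : DefinableFun (M := M) (vis v Θ) := by
  refine definableFun_set fun c => ?_
  convert (definableFun_color (v := v) {c}).union (definableFun_color (v := v) {c}).dia using 1
  ext x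
  simp [vis, or_and_right, exists_or]

/-- Finality is definable as the finite union, over `S`, of `vis = S` intersected with `□(vis ≠ S)`.
-/
theorem definableFun_data : DefinableFun (M := M) (data v Θ) := by
  refine definableFun_vis.prodMk (definableFun_color.prodMk (definableFun_prop ?_))
  convert Definable.iUnion fun S : Set (Color Θ) =>
    (definableFun_vis (v := v) {S}).inter (definableFun_vis (v := v) {S}ᶜ).box using 1
  ext x
  simp [IsFinal]

theorem definableFun_collapse : DefinableFun (M := M) (collapse v Θ) :=
  definableFun_data.comp collapseData

/-- Having the visible set of `x` is a definable property, so Löb's axiom gives a last point with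
it. -/
theorem exists_isFinal (hM : IsMagari M) (x : Point M) :
    ∃ y, (y = x ∨ x.Acc y) ∧ y.vis v Θ = x.vis v Θ ∧ y.IsFinal v Θ := by
  by_cases hx : x.IsFinal v Θ
  · exact ⟨x, Or.inl rfl, rfl, hx⟩
  · obtain ⟨a, ha⟩ := definableFun_vis (v := v) {x.vis v Θ}ᶜ
    simp only [Set.mem_preimage, Set.mem_compl_iff, Set.mem_singleton_iff] at ha
    have hbox : ModalAlgebra.box a ∉ x := fun h =>
      hx fun y hxy => (ha y).2 (hxy a h)
    obtain ⟨y, hxy, hy, hy'⟩ := exists_acc_of_box_notMem hM hbox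
    have hyx : y.vis v Θ = x.vis v Θ := by
      rw [← ha, not_not] at hy
      exact hy
    exact ⟨y, Or.inr hxy, hyx, fun z hyz => hyx ▸ (ha z).2 (hyz a hy')⟩

/-- Every colour occurring at or above a point survives the collapse. -/
theorem exists_collapse_eq (hM : IsMagari M) {c : Color Θ} (hc : c ∈ x.vis v Θ) :
    ∃ y, (y = x ∨ x.Acc y) ∧ (y.collapse v Θ).1 = c := by
  induction hn : (x.vis v Θ).ncard using Nat.strong_induction_on generalizing x with
  | _ n ih =>
    -- At a final `w` with the same visible set, `c` is either the colour that `w` keeps or occurs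
    -- above `w`, where strictly fewer colours are visible.
    obtain ⟨w, hxw, hw, hfin⟩ := exists_isFinal hM x (v := v) (Θ := Θ)
    have hacc : ∀ y, y = w ∨ w.Acc y → y = x ∨ x.Acc y := by
      rintro y (rfl | hy)
      · exact hxw
      · rcases hxw with rfl | hxw
        · exact Or.inr hy
        · exact Or.inr (hxw.trans hM hy)
    rw [← hw] at hc
    obtain ⟨z, rfl | hz, rfl⟩ := hc
    · exact ⟨z, hxw, collapse_of_isFinal hfin⟩
    · have hlt := Set.ncard_lt_ncard ((vis_subset hM hz).ssubset_of_ne (hfin z hz))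
      obtain ⟨y, hy, hy'⟩ := ih _ (by rw [← hn, ← hw]; exact hlt) (color_mem_vis z) rfl
      refine ⟨y, hacc y (Or.inr ?_), hy'⟩
      rcases hy with rfl | hy
      · exact hz
      · exact hz.trans hM hy

/-- A boxed formula false at a point is refuted in the collapse at an accessible point. -/
theorem exists_acc_collapse (hM : IsMagari M) {ψ : Fm} (hbox : Fm.box ψ ∈ Θ) (hψ : ψ ∈ Θ)
    (h : ModalAlgebra.box (eval v ψ) ∉ x) :
    ∃ y, x.Acc y ∧ (y.collapse v Θ).2 < (x.collapse v Θ).2 ∧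
      (⟨ψ, hψ⟩ : {φ // φ ∈ Θ}) ∉ (y.collapse v Θ).1 := by
  obtain ⟨z, hxz, hz, hz'⟩ := exists_acc_of_box_notMem hM h
  obtain ⟨y, hy, hyz⟩ := exists_collapse_eq hM (color_mem_vis z) (v := v) (Θ := Θ)
  have hxy : x.Acc y := by
    rcases hy with rfl | hy
    · exact hxz
    · exact hxz.trans hM hy
  -- Equal collapses are impossible: the colour of `z` contains `□ψ`, whereas `x` omits it.
  refine ⟨y, hxy, (collapse_eq_or_lt hM hxy).resolve_left fun e => ?_, by rwa [hyz]⟩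
  rw [← box_mem_collapse_iff hM hbox, ← e, hyz] at h
  exact h hz'

end Point

/-! ### The collapsed frame and its dual embedding -/

section Collapse

open Point

variable {M : Type u} [ModalAlgebra M] (v : ℕ → M) (Θ : Finset Fm)

/-- The frame of all collapsed points of a Magari algebra. -/
noncomputable abbrev collapseFrame : Frame.{0} :=
  colorFrame Θ (Set.range fun x : Point M => x.collapse v Θ)

/-- The collapse of a point as a point of the collapsed frame. -/
noncomputable def toCollapse (x : Point M) : (collapseFrame v Θ).carrier :=
  ⟨x.collapse v Θ, x, rfl⟩

theorem toCollapse_surjective : Function.Surjective (toCollapse v Θ) := by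
  rintro ⟨_, x, rfl⟩
  exact ⟨x, rfl⟩

variable {v Θ}

/-- The truth lemma. In the box case one direction is built into the relation of `colorFrame`; the
other is `exists_acc_collapse`. -/
theorem mem_eval_collapse_iff (hM : IsMagari M)
    (hand : ∀ φ ψ, Fm.and φ ψ ∈ Θ → φ ∈ Θ ∧ ψ ∈ Θ) (hneg : ∀ φ, neg φ ∈ Θ → φ ∈ Θ)
    (hbox : ∀ φ, box φ ∈ Θ → φ ∈ Θ) {φ : Fm} (hφ : φ ∈ Θ) (x : Point M) :
    Sat (colorVal Θ _) (toCollapse v Θ x) φ ↔ ⟨φ, hφ⟩ ∈ (x.collapse v Θ).1 := by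
  induction φ generalizing x with
  | var n => exact ⟨fun h => h.2, fun h => ⟨hφ, h⟩⟩
  | bot =>
    obtain ⟨y, -, hy⟩ := exists_color_eq_collapse hM x (v := v) (Θ := Θ)
    rw [← hy]
    exact iff_of_false (sat_bot _ _) y.bot_notMem
  | top =>
    obtain ⟨y, -, hy⟩ := exists_color_eq_collapse hM x (v := v) (Θ := Θ)
    rw [← hy]
    exact iff_of_true (sat_top _ _) y.top_mem
  | and φ ψ h k =>
    rw [sat_and, h (hand _ _ hφ).1, k (hand _ _ hφ).2]
    obtain ⟨y, -, hy⟩ := exists_color_eq_collapse hM x (v := v) (Θ := Θ)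
    rw [← hy]
    exact (y.inf_mem_iff _ _).symm
  | neg φ h =>
    rw [sat_neg, h (hneg _ hφ)]
    obtain ⟨y, -, hy⟩ := exists_color_eq_collapse hM x (v := v) (Θ := Θ)
    rw [← hy]
    exact (y.compl_mem_iff _).symm
  | box φ h =>
    rw [sat_box]
    refine ⟨fun hx => ?_, fun hx => ?_⟩
    · rw [box_mem_collapse_iff hM]
      by_contra hcon
      obtain ⟨y, hxy, hlt, hy⟩ := exists_acc_collapse hM hφ (hbox _ hφ) hcon
      refine hy ((h (hbox _ hφ) y).1 (hx _ ⟨hlt, fun _ _ => ?_⟩))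
      exact fun e he => collapse_of_acc hM hxy e he
    · intro q hq
      obtain ⟨y, rfl⟩ := toCollapse_surjective v Θ q
      exact (h (hbox _ hφ) y).2 (hq.2 _ ⟨φ, hbox _ hφ⟩ rfl hx).2

/-- The embedding sends `U` to the element defining its preimage under the collapse. Only `□⁺` is
stable in general, because a step between merged points becomes an equality. -/
theorem exists_isPreStableEmbedding_collapse (hM : IsMagari M)
    (hand : ∀ φ ψ, Fm.and φ ψ ∈ Θ → φ ∈ Θ ∧ ψ ∈ Θ) (hneg : ∀ φ, neg φ ∈ Θ → φ ∈ Θ)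
    (hbox : ∀ φ, box φ ∈ Θ → φ ∈ Θ) {D : Finset (Set (collapseFrame v Θ).carrier)}
    (hD : ∀ d ∈ D, ∃ φ, box φ ∈ Θ ∧ d = (boxPlus (eval (colorVal Θ _) φ))ᶜ) :
    ∃ h : (collapseFrame v Θ).Alg → M, IsPreStableEmbedding (collapseFrame v Θ) D h := by
  have hdef : ∀ U : (collapseFrame v Θ).Alg,
      ∃ a : M, ∀ x : Point M, toCollapse v Θ x ∈ U ↔ a ∈ x := by
    intro U
    obtain ⟨a, ha⟩ := definableFun_collapse (v := v) (Θ := Θ) (Subtype.val '' (U : Set _))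
    refine ⟨a, fun x => Iff.trans ?_ (ha x)⟩
    refine ⟨fun h => ⟨_, h, rfl⟩, ?_⟩
    rintro ⟨p, hp, hpx⟩
    have : p = toCollapse v Θ x := Subtype.ext hpx
    exact this ▸ hp
  choose h hh using hdef
  refine ⟨h, ?_, ?_, ?_, ?_, ?_, ?_, ?_⟩
  · refine eq_of_forall_mem_iff fun x => ?_
    rw [← hh]
    exact iff_of_false id x.bot_notMem
  · refine eq_of_forall_mem_iff fun x => ?_
    rw [← hh]
    exact iff_of_true trivial x.top_mem
  · intro U W
    refine eq_of_forall_mem_iff fun x => ?_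
    rw [inf_mem_iff, ← hh, ← hh, ← hh]
    rfl
  · intro U
    refine eq_of_forall_mem_iff fun x => ?_
    rw [compl_mem_iff, ← hh, ← hh]
    rfl
  · intro U
    refine le_of_forall_mem fun x hx => ?_
    rw [← hh] at hx
    rw [boxPlus, inf_mem_iff, box_mem_iff]
    refine ⟨fun y hxy => (hh U y).1 ?_, (hh U x).1 hx.2⟩
    rcases collapse_eq_or_lt hM hxy (v := v) (Θ := Θ) with e | hlt
    · have : toCollapse v Θ y = toCollapse v Θ x := Subtype.ext e
      rw [this]
      exact hx.2
    · exact hx.1 _ ⟨hlt, fun _ _ e he => collapse_of_acc hM hxy e he⟩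
  · intro W hW
    obtain ⟨φ, hφ, hWφ⟩ := hD _ hW
    obtain rfl : W = boxPlus (eval (colorVal Θ _) φ) := compl_injective hWφ
    have hmem : ∀ x : Point M, toCollapse v Θ x ∈ boxPlus (eval (colorVal Θ _) φ) ↔
        ⟨Fm.box φ, hφ⟩ ∈ (x.collapse v Θ).1 ∧ ⟨φ, hbox _ hφ⟩ ∈ (x.collapse v Θ).1 :=
      fun x => by
        rw [← mem_eval_collapse_iff hM hand hneg hbox hφ,
          ← mem_eval_collapse_iff hM hand hneg hbox (hbox _ hφ)]
        rfl
    refine eq_of_forall_mem_iff fun x => ?_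
    rw [← hh, box_mem_iff]
    simp only [← hh, hmem]
    -- Both sides amount to `□φ` holding at `x`.
    refine ⟨fun hx y hxy => ?_, fun hx => ?_⟩
    · refine collapse_of_acc hM hxy rfl ?_
      rw [← mem_eval_collapse_iff hM hand hneg hbox hφ]
      exact fun q hq => (hx q hq).2
    · intro q hq
      obtain ⟨z, rfl⟩ := toCollapse_surjective v Θ q
      refine (hmem z).2 (hq.2 _ _ rfl ((box_mem_collapse_iff hM hφ).2 ?_))
      by_contra hcon
      obtain ⟨y, hxy, -, hy⟩ := exists_acc_collapse hM hφ (hbox _ hφ) hcon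
      exact hy (hx y hxy).2
  · intro U hU e
    refine hU (Set.eq_univ_of_forall fun p => ?_)
    obtain ⟨x, rfl⟩ := toCollapse_surjective v Θ p
    exact (hh U x).2 (e ▸ x.top_mem)

/-- The collapsed frame refutes every rule that the valuation refutes. -/
theorem refutes_collapse (hM : IsMagari M)
    (hand : ∀ φ ψ, Fm.and φ ψ ∈ Θ → φ ∈ Θ ∧ ψ ∈ Θ) (hneg : ∀ φ, neg φ ∈ Θ → φ ∈ Θ)
    (hbox : ∀ φ, box φ ∈ Θ → φ ∈ Θ) {r : Rule} (hprem : r.prem ⊆ Θ) (hconcl : r.concl ⊆ Θ)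
    (h1 : ∀ γ ∈ r.prem, eval v γ = ⊤) (h2 : ∀ δ ∈ r.concl, eval v δ ≠ ⊤) :
    (∀ γ ∈ r.prem, eval (colorVal Θ (Set.range fun x : Point M => x.collapse v Θ)) γ = ⊤) ∧
    ∀ δ ∈ r.concl, eval (colorVal Θ (Set.range fun x : Point M => x.collapse v Θ)) δ ≠ ⊤ := by
  refine ⟨fun γ hγ => Set.eq_univ_of_forall fun p => ?_, fun δ hδ e => ?_⟩
  · obtain ⟨x, rfl⟩ := toCollapse_surjective v Θ p
    refine (mem_eval_collapse_iff hM hand hneg hbox (hprem hγ) x).2 ?_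
    obtain ⟨y, -, hy⟩ := exists_color_eq_collapse hM x (v := v) (Θ := Θ)
    rw [← hy]
    have : eval v γ ∈ y := (h1 γ hγ).symm ▸ y.top_mem
    exact this
  · obtain ⟨x, hx⟩ := exists_notMem_of_ne_top (h2 δ hδ)
    -- The point `x` refuting `δ` may itself be recoloured, but its colour survives at some `y`.
    obtain ⟨y, -, hy⟩ := exists_collapse_eq hM (color_mem_vis x) (v := v) (Θ := Θ)
    have := (mem_eval_collapse_iff hM hand hneg hbox (hconcl hδ) y).1
      (e.ge (Set.mem_univ (toCollapse v Θ y)))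
    rw [hy] at this
    exact hx this

end Collapse

/-! ### Axiomatization by classicized rules -/

namespace Fm

/-- The subformulae of a formula. -/
def sub : Fm → Finset Fm
  | var n => {var n}
  | bot => {bot}
  | top => {top}
  | and φ ψ => insert (and φ ψ) (sub φ ∪ sub ψ)
  | neg φ => insert (neg φ) (sub φ)
  | box φ => insert (box φ) (sub φ)

theorem self_mem_sub (φ : Fm) : φ ∈ sub φ := by
  cases φ <;> simp [sub]

theorem sub_subset {φ ψ : Fm} (h : φ ∈ sub ψ) : sub φ ⊆ sub ψ := by
  induction ψ with
  | var n => simp_all [sub]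
  | bot => simp_all [sub]
  | top => simp_all [sub]
  | and χ θ h1 h2 =>
    simp only [sub, Finset.mem_insert, Finset.mem_union] at h
    rcases h with rfl | h | h
    · rfl
    · exact (h1 h).trans (Finset.subset_union_left.trans (Finset.subset_insert _ _))
    · exact (h2 h).trans (Finset.subset_union_right.trans (Finset.subset_insert _ _))
  | neg χ h1 =>
    simp only [sub, Finset.mem_insert] at h
    rcases h with rfl | h
    · rfl
    · exact (h1 h).trans (Finset.subset_insert _ _)
  | box χ h1 =>
    simp only [sub, Finset.mem_insert] at h
    rcases h with rfl | h
    · rfl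
    · exact (h1 h).trans (Finset.subset_insert _ _)

end Fm

/-- The subformulae of the members of a rule. -/
def Rule.sub (r : Rule) : Finset Fm := (r.prem ∪ r.concl).biUnion Fm.sub

theorem Rule.mem_sub_of_mem_sub {r : Rule} {φ ψ : Fm} (h : φ ∈ Fm.sub ψ) (hψ : ψ ∈ r.sub) :
    φ ∈ r.sub := by
  obtain ⟨χ, hχ, hψχ⟩ := Finset.mem_biUnion.1 hψ
  exact Finset.mem_biUnion.2 ⟨χ, hχ, sub_subset hψχ h⟩

theorem Rule.mem_sub {r : Rule} {φ : Fm} (h : φ ∈ r.prem ∪ r.concl) : φ ∈ r.sub :=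
  Finset.mem_biUnion.2 ⟨φ, h, self_mem_sub φ⟩

/-- A choice of distinct variables for the elements of the dual algebra of a finite frame. -/
noncomputable def algVar (X : Frame.{0}) [Finite X.carrier] : X.Alg → ℕ :=
  (Countable.exists_injective_nat X.Alg).choose

theorem algVar_injective (X : Frame.{0}) [Finite X.carrier] : Function.Injective (algVar X) :=
  (Countable.exists_injective_nat X.Alg).choose_spec

/-- The domain given by the boxed subformulae of a rule on a coloured frame. -/
noncomputable def colorDomain (r : Rule) (s : Set (RankedColor r.sub)) :
    Finset (Set (colorFrame r.sub s).carrier) :=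
  (Set.toFinite {d : (colorFrame r.sub s).Alg |
    ∃ φ, box φ ∈ r.sub ∧ d = (boxPlus (eval (colorVal r.sub s) φ))ᶜ}).toFinset

theorem mem_colorDomain {r : Rule} {s : Set (RankedColor r.sub)} {d : (colorFrame r.sub s).Alg} :
    d ∈ colorDomain r s ↔ ∃ φ, box φ ∈ r.sub ∧ d = (boxPlus (eval (colorVal r.sub s) φ))ᶜ :=
  Set.Finite.mem_toFinset _

/-- The pre-stable canonical rule of a coloured frame. -/
noncomputable def colorRule (r : Rule) (s : Set (RankedColor r.sub)) : Rule :=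
  framePreStableRule (colorFrame r.sub s) (colorDomain r s) (algVar _)

theorem isClassicized_colorRule (r : Rule) (s : Set (RankedColor r.sub)) :
    IsClassicized (colorRule r s) := by
  refine ⟨_, inferInstance, _, _, colorFrame_isGL _ s, colorFrame_isSkeletal _ s, ?_,
    algVar_injective _, rfl⟩
  intro d hd
  obtain ⟨φ, -, rfl⟩ := mem_colorDomain.1 hd
  exact isDownset_compl_boxPlus (colorFrame_isTransitive _ s) _

/-- The rules of the coloured frames on which a given rule is refuted by the colours. -/
noncomputable def classicizedRules (r : Rule) : Finset Rule :=
  (Set.toFinite (colorRule r '' {s | (∀ γ ∈ r.prem, eval (colorVal r.sub s) γ = ⊤) ∧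
    ∀ δ ∈ r.concl, eval (colorVal r.sub s) δ ≠ ⊤})).toFinset

theorem isClassicized_of_mem_classicizedRules {r s : Rule} (hs : s ∈ classicizedRules r) :
    IsClassicized s := by
  obtain ⟨t, -, rfl⟩ := (Set.Finite.mem_toFinset _).1 hs
  exact isClassicized_colorRule r t

/-- Refuting a coloured rule means embedding its frame's algebra, which transports the refutation of
`r` by the colours; conversely, a refutation of `r` on `M` collapses to one of the listed frames. -/
theorem validates_iff_classicizedRules (r : Rule) (M : Type u) [ModalAlgebra M]
    (hM : IsMagari M) : Validates M r ↔ ∀ s ∈ classicizedRules r, Validates M s := by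
  have hand : ∀ φ ψ, Fm.and φ ψ ∈ r.sub → φ ∈ r.sub ∧ ψ ∈ r.sub := fun φ ψ h =>
    ⟨Rule.mem_sub_of_mem_sub (by simp [Fm.sub, self_mem_sub]) h,
      Rule.mem_sub_of_mem_sub (by simp [Fm.sub, self_mem_sub]) h⟩
  have hneg : ∀ φ, neg φ ∈ r.sub → φ ∈ r.sub := fun φ h =>
    Rule.mem_sub_of_mem_sub (by simp [Fm.sub, self_mem_sub]) h
  have hbox : ∀ φ, box φ ∈ r.sub → φ ∈ r.sub := fun φ h =>
    Rule.mem_sub_of_mem_sub (by simp [Fm.sub, self_mem_sub]) h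
  have hprem : r.prem ⊆ r.sub := fun φ h => Rule.mem_sub (Finset.mem_union_left _ h)
  have hconcl : r.concl ⊆ r.sub := fun φ h => Rule.mem_sub (Finset.mem_union_right _ h)
  simp only [classicizedRules, Set.Finite.mem_toFinset, Set.forall_mem_image]
  refine ⟨fun h s hs => ?_, fun h v hv => ?_⟩
  · by_contra hcon
    obtain ⟨e, he⟩ := (not_validates_framePreStableRule_iff (algVar_injective _)).1 hcon
    exact not_validates_of_isPreStableEmbedding hM (colorFrame_isGL _ s).1 he hand hneg hbox
      (fun φ hφ => mem_colorDomain.2 ⟨φ, hφ, rfl⟩) hprem hconcl hs.1 hs.2 h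
  · by_contra! hcon
    exact (not_validates_framePreStableRule_iff (algVar_injective _)).2
      (exists_isPreStableEmbedding_collapse hM hand hneg hbox fun d hd => mem_colorDomain.1 hd)
      (h (refutes_collapse hM hand hneg hbox hprem hconcl hv hcon))

end GLRules

theorem mainTheorem11 (r : GLRules.Rule) :
    ∃ Φ : Finset GLRules.Rule,
      (∀ s ∈ Φ, GLRules.IsClassicized s) ∧
      GLRules.extend GLRules.systemGL {r} =
        GLRules.extend GLRules.systemGL {s : GLRules.Rule | s ∈ Φ} ∧
      ∀ (M : Type u) [GLRules.ModalAlgebra M], GLRules.IsMagari M →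
        (GLRules.Validates M r ↔ ∀ s ∈ Φ, GLRules.Validates M s) := by
  open GLRules in
  refine ⟨classicizedRules r, fun s => isClassicized_of_mem_classicizedRules,
    (extend_subset_extend ?_).antisymm (extend_subset_extend ?_),
    fun M _ hM => validates_iff_classicizedRules r M hM⟩
  · intro M _ hM h s hs
    rw [Set.mem_singleton_iff.1 hs]
    exact (validates_iff_classicizedRules r M hM).2 h
  · exact fun M _ hM h => (validates_iff_classicizedRules r M hM).1 (h r rfl)
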